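/- Let $k$ be a commutative ring. For a commutative $k$-algebra $R$ let $\mathrm{Br}(R)$ be the Brauer group of $R$: the group of Azumaya $R$-algebras modulo the relation $A\sim B$ iff $A\otimes_R\mathrm{End}_R(P)\cong B\otimes_R\mathrm{End}_R(Q)$ as $R$-algebras for some faithful finitely generated projective $R$-modules $P,Q$, with product $[A][B]=[A\otimes_R B]$, unit $[R]$ and inverse $[A]^{-1}=[A^{\mathrm{op}}]$. A morphism of commutative $k$-algebras $\varrho:R\to T$ induces the group homomorphism $\mathrm{Br}(\varrho):\mathrm{Br}(R)\to\mathrm{Br}(T)$, $[A]\mapsto[T\otimes_R A]$. For a finite group $G$, a $G$-Galois-Azumaya extension of $R$ is an Azumaya $R$-algebra $S$, with an action of $G$ on $S$ by ring automorphisms that is trivial on the image of $R$, such that $S$ is faithfully flat over $R$ and the map $$\Gamma:S\otimes_R S\to \prod_{g\in G}S,\qquad s\otimes t\mapsto (s\,g(t))_{g\in G},$$ is bijective. The Brauer-Galois group $\mathrm{Br}_{\mathrm{Gal}}(R)$ is the subgroup of $\mathrm{Br}(R)$ consisting of the classes $[S]$ of all $G$-Galois-Azumaya extensions $S$ of $R$,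 for all finite groups $G$. **Corollary 3.8.** The assignment $R\mapsto\mathrm{Br}_{\mathrm{Gal}}(R)$ defines a functor from the category of commutative $k$-algebras to the category of groups. For each morphism $\varrho:R\to T$ of commutative $k$-algebras, the map $\mathrm{Br}_{\mathrm{Gal}}(\varrho)$ is the homomorphism of groups $\mathrm{Br}_{\mathrm{Gal}}(R)\to\mathrm{Br}_{\mathrm{Gal}}(T)$ induced by extension of scalars along $\varrho$; that is, $\mathrm{Br}(\varrho)$ maps $\mathrm{Br}_{\mathrm{Gal}}(R)$ into $\mathrm{Br}_{\mathrm{Gal}}(T)$ and $\mathrm{Br}_{\mathrm{Gal}}(\varrho)$ is the restriction of $\mathrm{Br}(\varrho)$. -/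

import Mathlib

open scoped TensorProduct

universe u v

namespace BrauerGalois

/-! ### Faithful finitely generated projective modules -/

/-- A faithful finitely generated projective module over a commutative ring. -/
class IsFaithfullyProjective (R : Type*) (P : Type*) [CommRing R] [AddCommGroup P] [Module R P] :
    Prop extends Module.Finite R P, Module.Projective R P, FaithfulSMul R P

section Modules

variable {R : Type*} [CommRing R] {P Q : Type*} [AddCommGroup P] [Module R P]
  [AddCommGroup Q] [Module R Q]

theorem exists_dualBasis [Module.Finite R P] [Module.Projective R P] :
    ∃ (n : ℕ) (p : Fin n → P) (φ : Fin n → (P →ₗ[R] R)), ∀ x, ∑ i, φ i x • p i = x := by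
  obtain ⟨n, f, g, -, -, h⟩ := Module.Finite.exists_comp_eq_id_of_projective R P
  refine ⟨n, fun i => f (Pi.single i 1), fun i => LinearMap.proj i ∘ₗ g, fun x => ?_⟩
  have h2 : f (g x) = x := LinearMap.congr_fun h x
  conv_rhs => rw [← h2, pi_eq_sum_univ' (g x), map_sum]
  simp only [map_smul, LinearMap.comp_apply, LinearMap.proj_apply]

theorem exists_one_eq_sum (R P : Type*) [CommRing R] [AddCommGroup P] [Module R P]
    [IsFaithfullyProjective R P] :
    ∃ (n : ℕ) (p : Fin n → P) (φ : Fin n → (P →ₗ[R] R)), ∑ i, φ i (p i) = 1 := by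
  let I : Ideal R := Ideal.span {r | ∃ (φ : P →ₗ[R] R) (p : P), φ p = r}
  obtain ⟨n, p, φ, h⟩ := exists_dualBasis (R := R) (P := P)
  have hle : (⊤ : Submodule R P) ≤ I • ⊤ := by
    intro x _
    rw [← h x]
    exact Submodule.sum_mem _ fun i _ =>
      Submodule.smul_mem_smul (Ideal.subset_span ⟨φ i, x, rfl⟩) trivial
  obtain ⟨r, hr, hr'⟩ := Submodule.exists_mem_and_smul_eq_self_of_fg_of_le_smul I ⊤
    Module.Finite.fg_top hle
  have h1 : r = 1 := FaithfulSMul.eq_of_smul_eq_smul (α := P) fun x => by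
    rw [hr' x trivial, one_smul]
  subst h1
  have key : ∀ x ∈ I, ∃ (n : ℕ) (p : Fin n → P) (φ : Fin n → (P →ₗ[R] R)),
      ∑ i, φ i (p i) = x := by
    intro x hx
    induction hx using Submodule.span_induction with
    | mem x hx =>
      obtain ⟨φ, p, rfl⟩ := hx
      exact ⟨1, fun _ => p, fun _ => φ, by simp⟩
    | zero => exact ⟨0, fun _ => 0, fun _ => 0, by simp⟩
    | add x y _ _ hx hy =>
      obtain ⟨n, p, φ, rfl⟩ := hx
      obtain ⟨m, q, ψ, rfl⟩ := hy
      exact ⟨n + m, Fin.append p q, Fin.append φ ψ, by simp [Fin.sum_univ_add]⟩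
    | smul a x _ hx =>
      obtain ⟨n, p, φ, rfl⟩ := hx
      exact ⟨n, p, fun i => a • φ i, by simp [Finset.mul_sum]⟩
  exact key 1 hr

instance (priority := 50) isFaithfullyProjective_self : IsFaithfullyProjective R R where

theorem isFaithfullyProjective_tensor' (R T M N : Type*) [CommRing R] [CommRing T] [Algebra R T]
    [AddCommGroup M] [Module R M] [Module T M] [IsScalarTower R T M]
    [AddCommGroup N] [Module R N] [IsFaithfullyProjective T M] [IsFaithfullyProjective R N] :
    IsFaithfullyProjective T (M ⊗[R] N) where
  toFinite := Module.Finite.equiv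
    (TensorProduct.AlgebraTensorModule.cancelBaseChange R T T M N)
  toProjective := inferInstance
  eq_of_smul_eq_smul {a b} h := by
    obtain ⟨m, p, φ, hp⟩ := exists_one_eq_sum T M
    obtain ⟨n, q, ψ, hq⟩ := exists_one_eq_sum R N
    have h1 : ∀ t : T, ∑ i, ∑ j, (TensorProduct.AlgebraTensorModule.rid R T T ∘ₗ
        TensorProduct.AlgebraTensorModule.map (φ i) (ψ j)) (t • (p i ⊗ₜ q j)) = t := by
      intro t
      simp only [map_smul, LinearMap.comp_apply, TensorProduct.AlgebraTensorModule.map_tmul,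
        ← Finset.smul_sum]
      simp [← Finset.sum_smul, hq, hp]
    rw [← h1 a, ← h1 b]
    simp only [h]

instance isFaithfullyProjective_tensor [IsFaithfullyProjective R P]
    [IsFaithfullyProjective R Q] : IsFaithfullyProjective R (P ⊗[R] Q) :=
  isFaithfullyProjective_tensor' R R P Q

instance isFaithfullyProjective_baseChange (T : Type*) [CommRing T] [Algebra R T]
    [IsFaithfullyProjective R P] : IsFaithfullyProjective T (T ⊗[R] P) :=
  isFaithfullyProjective_tensor' R T T P

end Modules

section EndTensor

open TensorProduct.AlgebraTensorModule in
theorem bijective_endTensorEnd (R A M N : Type*) [CommRing R] [CommRing A] [Algebra R A]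
    [AddCommGroup M] [Module R M] [Module A M] [IsScalarTower R A M]
    [AddCommGroup N] [Module R N] [Module.Finite A M] [Module.Projective A M]
    [Module.Finite R N] [Module.Projective R N] :
    Function.Bijective (Module.endTensorEndAlgHom (R := R) (S := A) (A := A) (M := M) (N := N)) := by
  obtain ⟨m, p, φ, hp⟩ := exists_dualBasis (R := A) (P := M)
  obtain ⟨n, q, ψ, hq⟩ := exists_dualBasis (R := R) (P := N)
  let L : Fin m → Fin n → (M ⊗[R] N →ₗ[A] Module.End A M ⊗[R] Module.End R N) := fun i j =>
    TensorProduct.AlgebraTensorModule.map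
      (LinearMap.smulRightₗ (φ i) : M →ₗ[A] Module.End A M)
      (LinearMap.smulRightₗ (ψ j) : N →ₗ[R] Module.End R N)
  let inv : Module.End A (M ⊗[R] N) → Module.End A M ⊗[R] Module.End R N := fun F =>
    ∑ i, ∑ j, L i j (F (p i ⊗ₜ q j))
  have h1 : Function.LeftInverse inv
      (Module.endTensorEndAlgHom (R := R) (S := A) (A := A) (M := M) (N := N)) := by
    intro z
    induction z using TensorProduct.induction_on with
    | zero => simp [inv]
    | add x y hx hy =>
      rw [← hx, ← hy]
      simp only [inv, map_add, LinearMap.add_apply, Finset.sum_add_distrib] at hx hy ⊢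
      simp only [hx, hy]
    | tmul f g =>
      simp only [inv, L, Module.endTensorEndAlgHom_apply, map_tmul, ← TensorProduct.tmul_sum,
        ← TensorProduct.sum_tmul]
      congr 1
      · ext x
        simp only [LinearMap.sum_apply, LinearMap.smulRightₗ_apply]
        conv_rhs => rw [← hp x, map_sum]
        simp
      · ext x
        simp only [LinearMap.sum_apply, LinearMap.smulRightₗ_apply]
        conv_rhs => rw [← hq x, map_sum]
        simp
  have h2 : Function.RightInverse inv
      (Module.endTensorEndAlgHom (R := R) (S := A) (A := A) (M := M) (N := N)) := by
    have h3 : ∀ (i : Fin m) (j : Fin n) (z : M ⊗[R] N) (x : M) (y : N),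
        (Module.endTensorEndAlgHom (R := R) (S := A) (A := A) (L i j z)) (x ⊗ₜ y) =
          φ i x • ψ j y • z := by
      intro i j z x y
      induction z using TensorProduct.induction_on with
      | zero => simp
      | add a b ha hb => simp only [map_add, LinearMap.add_apply, ha, hb, smul_add]
      | tmul a b =>
        simp only [L, map_tmul, Module.endTensorEndAlgHom_apply]
        change (φ i x • a) ⊗ₜ[R] (ψ j y • b) = _
        rw [TensorProduct.tmul_smul, ← TensorProduct.smul_tmul', smul_comm]
    have h4 : ∀ (x : M) (y : N),
        ∑ i, ∑ j, φ i x • ψ j y • (p i ⊗ₜ[R] q j) = x ⊗ₜ[R] y := by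
      intro x y
      conv_rhs => rw [← hp x, ← hq y, TensorProduct.sum_tmul]
      refine Finset.sum_congr rfl fun i _ => ?_
      rw [TensorProduct.tmul_sum]
      refine Finset.sum_congr rfl fun j _ => ?_
      rw [TensorProduct.tmul_smul, ← TensorProduct.smul_tmul', smul_comm]
    intro F
    ext x y
    simp only [inv, map_sum, LinearMap.sum_apply, curry_apply, LinearMap.restrictScalars_apply,
      TensorProduct.curry_apply, h3]
    rw [← h4 x y]
    simp only [map_sum, map_smul, LinearMap.map_smul_of_tower]
  exact ⟨h1.injective, h2.surjective⟩

end EndTensor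

/-! ### Azumaya algebras -/

section Azumaya

theorem isFaithfullyProjective_of_isAzumaya (R A : Type*) [CommRing R] [Ring A] [Algebra R A]
    [IsAzumaya R A] : IsFaithfullyProjective R A where
  eq_of_smul_eq_smul := FaithfulSMul.eq_of_smul_eq_smul

attribute [local instance] isFaithfullyProjective_of_isAzumaya

open MulOpposite in
theorem isAzumaya_tensor' (R T A B : Type*) [CommRing R] [CommRing T] [Algebra R T]
    [Ring A] [Algebra R A] [Algebra T A] [IsScalarTower R T A] [Ring B] [Algebra R B]
    [IsAzumaya T A] [IsAzumaya R B] : IsAzumaya T (A ⊗[R] B) := by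
  have := isFaithfullyProjective_tensor' R T A B
  let e1 : (A ⊗[R] B) ⊗[T] (A ⊗[R] B)ᵐᵒᵖ ≃ₗ[T] (A ⊗[T] Aᵐᵒᵖ) ⊗[R] (B ⊗[R] Bᵐᵒᵖ) :=
    TensorProduct.congr (LinearEquiv.refl T _)
        (Algebra.TensorProduct.opAlgEquiv R T A B).symm.toLinearEquiv ≪≫ₗ
      TensorProduct.AlgebraTensorModule.tensorTensorTensorComm R R T T A B Aᵐᵒᵖ Bᵐᵒᵖ
  let e2 : (A ⊗[T] Aᵐᵒᵖ) ⊗[R] (B ⊗[R] Bᵐᵒᵖ) ≃ₗ[T] Module.End T A ⊗[R] Module.End R B :=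
    TensorProduct.AlgebraTensorModule.congr
      (LinearEquiv.ofBijective (AlgHom.mulLeftRight T A).toLinearMap IsAzumaya.bij)
      (LinearEquiv.ofBijective (AlgHom.mulLeftRight R B).toLinearMap IsAzumaya.bij)
  let e3 : Module.End T A ⊗[R] Module.End R B ≃ₗ[T] Module.End T (A ⊗[R] B) :=
    LinearEquiv.ofBijective (Module.endTensorEndAlgHom (R := R) (S := T) (A := T) (M := A)
      (N := B)).toLinearMap (bijective_endTensorEnd R T A B)
  refine { toFaithfulSMul := this.toFaithfulSMul, bij := ?_ }
  have key : (AlgHom.mulLeftRight T (A ⊗[R] B)).toLinearMap = (e1 ≪≫ₗ e2 ≪≫ₗ e3).toLinearMap := by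
    refine TensorProduct.ext' fun x y => ?_
    induction x using TensorProduct.induction_on with
    | zero => simp
    | add x x' hx hx' => rw [TensorProduct.add_tmul, map_add, map_add, hx, hx']
    | tmul a b =>
      obtain ⟨y, rfl⟩ := op_surjective y
      induction y using TensorProduct.induction_on with
      | zero => simp
      | add y y' hy hy' =>
        rw [op_add, TensorProduct.tmul_add, map_add, map_add, hy, hy']
      | tmul a' b' =>
        refine LinearMap.ext fun z => ?_
        induction z using TensorProduct.induction_on with
        | zero => simp
        | add z z' hz hz' => rw [map_add, map_add, hz, hz']
        | tmul c d =>
          have : (e1 ≪≫ₗ e2 ≪≫ₗ e3).toLinearMap ((a ⊗ₜ b) ⊗ₜ[T] op (a' ⊗ₜ b')) (c ⊗ₜ d) =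
            (AlgHom.mulLeftRight T A (a ⊗ₜ op a') c) ⊗ₜ
              (AlgHom.mulLeftRight R B (b ⊗ₜ op b') d) := rfl
          rw [this]
          simp
  have : Function.Bijective (AlgHom.mulLeftRight T (A ⊗[R] B)).toLinearMap := by
    rw [key]
    exact (e1 ≪≫ₗ e2 ≪≫ₗ e3).bijective
  exact this

instance isAzumaya_tensor (R A B : Type*) [CommRing R] [Ring A] [Algebra R A] [Ring B]
    [Algebra R B] [IsAzumaya R A] [IsAzumaya R B] : IsAzumaya R (A ⊗[R] B) :=
  isAzumaya_tensor' R R A B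

instance isAzumaya_baseChange (R T A : Type*) [CommRing R] [CommRing T] [Algebra R T] [Ring A]
    [Algebra R A] [IsAzumaya R A] : IsAzumaya T (T ⊗[R] A) :=
  have : IsAzumaya T T := IsAzumaya.id T
  isAzumaya_tensor' R T T A

open MulOpposite in
instance isAzumaya_op (R A : Type*) [CommRing R] [Ring A] [Algebra R A] [IsAzumaya R A] :
    IsAzumaya R Aᵐᵒᵖ := by
  have : Module.Finite R Aᵐᵒᵖ := Module.Finite.equiv (opLinearEquiv R)
  have : Module.Projective R Aᵐᵒᵖ := Module.Projective.of_equiv (opLinearEquiv R)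
  have : FaithfulSMul R Aᵐᵒᵖ := ⟨fun {a b} h => FaithfulSMul.eq_of_smul_eq_smul (α := A)
    fun x => op_injective (by simpa using h (op x))⟩
  refine { bij := ?_ }
  let e1 : Aᵐᵒᵖ ⊗[R] Aᵐᵒᵖᵐᵒᵖ ≃ₗ[R] A ⊗[R] Aᵐᵒᵖ :=
    TensorProduct.congr (LinearEquiv.refl R _)
      ((opLinearEquiv R).symm ≪≫ₗ (opLinearEquiv R).symm) ≪≫ₗ TensorProduct.comm R Aᵐᵒᵖ A
  let e2 : A ⊗[R] Aᵐᵒᵖ ≃ₗ[R] Module.End R A :=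
    LinearEquiv.ofBijective (AlgHom.mulLeftRight R A).toLinearMap IsAzumaya.bij
  let e3 : Module.End R A ≃ₗ[R] Module.End R Aᵐᵒᵖ := (opLinearEquiv R).conj
  have key : (AlgHom.mulLeftRight R Aᵐᵒᵖ).toLinearMap = (e1 ≪≫ₗ e2 ≪≫ₗ e3).toLinearMap := by
    refine TensorProduct.ext' fun x y => LinearMap.ext fun z => ?_
    have : (e1 ≪≫ₗ e2 ≪≫ₗ e3).toLinearMap (x ⊗ₜ y) z =
      op (AlgHom.mulLeftRight R A (y.unop.unop ⊗ₜ x) z.unop) := rfl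
    rw [this]
    apply unop_injective
    simp [mul_assoc]
  have : Function.Bijective (AlgHom.mulLeftRight R Aᵐᵒᵖ).toLinearMap := by
    rw [key]
    exact (e1 ≪≫ₗ e2 ≪≫ₗ e3).bijective
  exact this

/-- An Azumaya algebra over `R`. Since it is a finitely generated `R`-module, the restriction to the
universe of `R` loses no isomorphism class. -/
structure AzumayaAlgebra (R : Type u) [CommRing R] : Type (u + 1) where
  /-- the underlying type -/
  carrier : Type u
  [ring : Ring carrier]
  [algebra : Algebra R carrier]
  [isAzumaya : IsAzumaya R carrier]

attribute [instance] AzumayaAlgebra.ring AzumayaAlgebra.algebra AzumayaAlgebra.isAzumaya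

instance (R : Type u) [CommRing R] : CoeSort (AzumayaAlgebra R) (Type u) :=
  ⟨AzumayaAlgebra.carrier⟩

/-- Brauer equivalence (stable isomorphism) of algebras: `A ⊗ End P ≃ B ⊗ End Q` for
some faithful finitely generated projective `R`-modules `P` and `Q`. -/
def IsBrauerEquivalent (R : Type u) [CommRing R] (A B : Type u) [Ring A] [Algebra R A]
    [Ring B] [Algebra R B] : Prop :=
  ∃ (P : Type u) (_ : AddCommGroup P) (_ : Module R P)
    (Q : Type u) (_ : AddCommGroup Q) (_ : Module R Q),
    IsFaithfullyProjective R P ∧ IsFaithfullyProjective R Q ∧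
      Nonempty (A ⊗[R] Module.End R P ≃ₐ[R] B ⊗[R] Module.End R Q)

/-- The canonical isomorphism `End_T M ⊗[R] End_R N ≃ End_T (M ⊗[R] N)`. -/
noncomputable def endTensorEquiv (R T M N : Type*) [CommRing R] [CommRing T] [Algebra R T]
    [AddCommGroup M] [Module R M] [Module T M] [IsScalarTower R T M]
    [AddCommGroup N] [Module R N] [IsFaithfullyProjective T M] [IsFaithfullyProjective R N] :
    Module.End T M ⊗[R] Module.End R N ≃ₐ[T] Module.End T (M ⊗[R] N) :=
  AlgEquiv.ofBijective _ (bijective_endTensorEnd R T M N)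

/-- `R` is its own endomorphism algebra. -/
noncomputable def selfEquivEnd (R : Type*) [CommRing R] : R ≃ₐ[R] Module.End R R :=
  (AlgEquiv.toOpposite R R).trans (AlgEquiv.moduleEndSelf R)

/-- `(A ⊗ B) ⊗ C ≃ (A ⊗ C) ⊗ B`. -/
noncomputable def rightCommEquiv (R A B C : Type*) [CommRing R] [Ring A] [Algebra R A] [Ring B]
    [Algebra R B] [Ring C] [Algebra R C] : (A ⊗[R] B) ⊗[R] C ≃ₐ[R] (A ⊗[R] C) ⊗[R] B :=
  ((Algebra.TensorProduct.assoc R R R A B C).trans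
    (Algebra.TensorProduct.congr AlgEquiv.refl (Algebra.TensorProduct.comm R B C))).trans
    (Algebra.TensorProduct.assoc R R R A C B).symm

/-- `T ⊗ (A ⊗ B) ≃ (T ⊗ A) ⊗ (T ⊗ B)`. -/
noncomputable def distribEquiv (R T A B : Type*) [CommRing R] [CommRing T] [Algebra R T]
    [Ring A] [Algebra R A] [Ring B] [Algebra R B] :
    T ⊗[R] (A ⊗[R] B) ≃ₐ[T] (T ⊗[R] A) ⊗[T] (T ⊗[R] B) :=
  (Algebra.TensorProduct.congr (Algebra.TensorProduct.lid T T).symm AlgEquiv.refl).trans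
    (Algebra.TensorProduct.tensorTensorTensorComm R T R T T T A B)

namespace IsBrauerEquivalent

variable {R : Type u} [CommRing R] {A B C D : Type u} [Ring A] [Algebra R A]
  [Ring B] [Algebra R B] [Ring C] [Algebra R C] [Ring D] [Algebra R D]

theorem of_algEquiv (e : A ≃ₐ[R] B) : IsBrauerEquivalent R A B :=
  ⟨R, inferInstance, inferInstance, R, inferInstance, inferInstance, inferInstance, inferInstance,
    ⟨Algebra.TensorProduct.congr e AlgEquiv.refl⟩⟩

theorem symm (h : IsBrauerEquivalent R A B) : IsBrauerEquivalent R B A := by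
  obtain ⟨P, _, _, Q, _, _, hP, hQ, ⟨e⟩⟩ := h
  exact ⟨Q, inferInstance, inferInstance, P, inferInstance, inferInstance, hQ, hP, ⟨e.symm⟩⟩

theorem trans (h : IsBrauerEquivalent R A B) (h' : IsBrauerEquivalent R B C) :
    IsBrauerEquivalent R A C := by
  obtain ⟨P, _, _, Q, _, _, hP, hQ, ⟨e⟩⟩ := h
  obtain ⟨P', _, _, Q', _, _, hP', hQ', ⟨e'⟩⟩ := h'
  refine ⟨P ⊗[R] P', inferInstance, inferInstance, Q' ⊗[R] Q, inferInstance, inferInstance,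
    inferInstance, inferInstance, ⟨?_⟩⟩
  exact (Algebra.TensorProduct.congr AlgEquiv.refl (endTensorEquiv R R P P').symm).trans <|
    (Algebra.TensorProduct.assoc R R R A _ _).symm.trans <|
    (Algebra.TensorProduct.congr e AlgEquiv.refl).trans <|
    (rightCommEquiv R B _ _).trans <|
    (Algebra.TensorProduct.congr e' AlgEquiv.refl).trans <|
    (Algebra.TensorProduct.assoc R R R C _ _).trans <|
    Algebra.TensorProduct.congr AlgEquiv.refl (endTensorEquiv R R Q' Q)

theorem tensor (h : IsBrauerEquivalent R A B) (h' : IsBrauerEquivalent R C D) :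
    IsBrauerEquivalent R (A ⊗[R] C) (B ⊗[R] D) := by
  obtain ⟨P, _, _, Q, _, _, hP, hQ, ⟨e⟩⟩ := h
  obtain ⟨P', _, _, Q', _, _, hP', hQ', ⟨e'⟩⟩ := h'
  refine ⟨P ⊗[R] P', inferInstance, inferInstance, Q ⊗[R] Q', inferInstance, inferInstance,
    inferInstance, inferInstance, ⟨?_⟩⟩
  exact (Algebra.TensorProduct.congr AlgEquiv.refl (endTensorEquiv R R P P').symm).trans <|
    (Algebra.TensorProduct.tensorTensorTensorComm R R R R A C _ _).trans <|
    (Algebra.TensorProduct.congr e e').trans <|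
    (Algebra.TensorProduct.tensorTensorTensorComm R R R R B _ D _).trans <|
    Algebra.TensorProduct.congr AlgEquiv.refl (endTensorEquiv R R Q Q')

theorem end_self (R P : Type u) [CommRing R] [AddCommGroup P] [Module R P]
    [IsFaithfullyProjective R P] : IsBrauerEquivalent R (Module.End R P) R :=
  ⟨R, inferInstance, inferInstance, P, inferInstance, inferInstance, inferInstance, inferInstance,
    ⟨(Algebra.TensorProduct.congr AlgEquiv.refl (selfEquivEnd R).symm).trans
      (Algebra.TensorProduct.comm R _ R)⟩⟩

theorem tensor_op (R A : Type u) [CommRing R] [Ring A] [Algebra R A] [IsAzumaya R A] :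
    IsBrauerEquivalent R (A ⊗[R] Aᵐᵒᵖ) R :=
  (of_algEquiv (AlgEquiv.ofBijective (AlgHom.mulLeftRight R A) IsAzumaya.bij)).trans
    (end_self R A)

theorem baseChange (T : Type u) [CommRing T] [Algebra R T] (h : IsBrauerEquivalent R A B) :
    IsBrauerEquivalent T (T ⊗[R] A) (T ⊗[R] B) := by
  obtain ⟨P, _, _, Q, _, _, hP, hQ, ⟨e⟩⟩ := h
  refine ⟨T ⊗[R] P, inferInstance, inferInstance, T ⊗[R] Q, inferInstance, inferInstance,
    inferInstance, inferInstance, ⟨?_⟩⟩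
  let f (N : Type u) [AddCommGroup N] [Module R N] [IsFaithfullyProjective R N] :
      T ⊗[R] Module.End R N ≃ₐ[T] Module.End T (T ⊗[R] N) :=
    (Algebra.TensorProduct.congr (selfEquivEnd T) AlgEquiv.refl).trans (endTensorEquiv R T T N)
  exact (Algebra.TensorProduct.congr AlgEquiv.refl (f P).symm).trans <|
    (distribEquiv R T A _).symm.trans <|
    (Algebra.TensorProduct.congr AlgEquiv.refl e).trans <|
    (distribEquiv R T B _).trans <|
    Algebra.TensorProduct.congr AlgEquiv.refl (f Q)

end IsBrauerEquivalent

/-- Brauer equivalence of Azumaya algebras. -/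
instance brauerSetoid (R : Type u) [CommRing R] : Setoid (AzumayaAlgebra R) where
  r A B := IsBrauerEquivalent R A B
  iseqv := ⟨fun _ => .of_algEquiv AlgEquiv.refl, fun h => h.symm, fun h h' => h.trans h'⟩

end Azumaya

/-! ### The Brauer group of a commutative ring -/

/-- The Brauer group of a commutative ring: Azumaya algebras modulo Brauer equivalence. -/
def Br (R : Type u) [CommRing R] : Type (u + 1) := Quotient (brauerSetoid R)

namespace Br

variable {R : Type u} [CommRing R]

/-- The Brauer class `[A]` of an Azumaya `R`-algebra `A`. -/
def mk (R : Type u) [CommRing R] (A : Type u) [Ring A] [Algebra R A] [IsAzumaya R A] : Br R :=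
  Quotient.mk (brauerSetoid R) ⟨A⟩

theorem mk_eq_mk {A B : Type u} [Ring A] [Algebra R A] [IsAzumaya R A] [Ring B] [Algebra R B]
    [IsAzumaya R B] : mk R A = mk R B ↔ IsBrauerEquivalent R A B :=
  Quotient.eq (r := brauerSetoid R)

theorem mk_eq_of_algEquiv {A B : Type u} [Ring A] [Algebra R A] [IsAzumaya R A] [Ring B]
    [Algebra R B] [IsAzumaya R B] (e : A ≃ₐ[R] B) : mk R A = mk R B :=
  mk_eq_mk.2 (.of_algEquiv e)

theorem ind {p : Br R → Prop}
    (h : ∀ (A : Type u) [Ring A] [Algebra R A] [IsAzumaya R A], p (mk R A)) (x : Br R) : p x :=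
  Quotient.inductionOn x fun A => h A

/-- The product of two Brauer classes is `[A][B] = [A ⊗ B]`. -/
instance : Mul (Br R) where
  mul := Quotient.map₂ (fun A B => ⟨A ⊗[R] B⟩) fun _ _ h _ _ h' => h.tensor h'

/-- The unit class is `[R]`. -/
instance : One (Br R) where
  one := have : IsAzumaya R R := IsAzumaya.id R; mk R R

theorem mk_mul_mk (A B : Type u) [Ring A] [Algebra R A] [IsAzumaya R A] [Ring B] [Algebra R B]
    [IsAzumaya R B] : mk R A * mk R B = mk R (A ⊗[R] B) := rfl

theorem one_eq [IsAzumaya R R] : (1 : Br R) = mk R R := rfl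

instance : CommMonoid (Br R) where
  mul_assoc x y z := by
    induction x using ind with | h A
    induction y using ind with | h B
    induction z using ind with | h C
    simp only [mk_mul_mk]
    exact mk_eq_of_algEquiv (Algebra.TensorProduct.assoc R R R A B C)
  mul_comm x y := by
    induction x using ind with | h A
    induction y using ind with | h B
    exact mk_eq_of_algEquiv (Algebra.TensorProduct.comm R A B)
  one_mul x := by
    have : IsAzumaya R R := IsAzumaya.id R
    induction x using ind with | h A
    exact mk_eq_of_algEquiv (Algebra.TensorProduct.lid R A)
  mul_one x := by
    have : IsAzumaya R R := IsAzumaya.id R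
    induction x using ind with | h A
    exact mk_eq_of_algEquiv (Algebra.TensorProduct.rid R R A)

theorem mk_mul_mk_op (A : Type u) [Ring A] [Algebra R A] [IsAzumaya R A] :
    mk R A * mk R Aᵐᵒᵖ = 1 :=
  have : IsAzumaya R R := IsAzumaya.id R
  mk_eq_mk.2 (IsBrauerEquivalent.tensor_op R A)

/-- The inverse of `[A]` is the class of the opposite algebra. -/
instance : Inv (Br R) where
  inv := Quotient.lift (fun A => mk R Aᵐᵒᵖ) fun A B h => by
    have h1 : mk R A = mk R B := mk_eq_mk.2 h
    refine left_inv_eq_right_inv (a := mk R A) ?_ ?_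
    · rw [mul_comm, mk_mul_mk_op]
    · rw [h1, mk_mul_mk_op]

theorem inv_mk (A : Type u) [Ring A] [Algebra R A] [IsAzumaya R A] :
    (mk R A)⁻¹ = mk R Aᵐᵒᵖ := rfl

instance : CommGroup (Br R) where
  inv_mul_cancel x := by
    induction x using ind with | h A
    rw [inv_mk, mul_comm, mk_mul_mk_op]

/-- The homomorphism `Br(R) → Br(T)`, `[A] ↦ [T ⊗ A]`, for a commutative `R`-algebra `T`. -/
noncomputable def baseChange (R T : Type u) [CommRing R] [CommRing T] [Algebra R T] :
    Br R →* Br T :=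
  MonoidHom.mk' (Quotient.map (fun A => ⟨T ⊗[R] A⟩) fun _ _ h => h.baseChange T) fun x y => by
    induction x using ind with | h A
    induction y using ind with | h B
    exact mk_eq_of_algEquiv (distribEquiv R T A B)

theorem baseChange_mk (R T : Type u) [CommRing R] [CommRing T] [Algebra R T]
    (A : Type u) [Ring A] [Algebra R A] [IsAzumaya R A] :
    baseChange R T (mk R A) = mk T (T ⊗[R] A) := rfl

/-- The homomorphism `Br(ρ) : Br(R) → Br(T)` induced by extension of scalars along a ring
homomorphism `ρ : R → T`. -/
noncomputable def map {R T : Type u} [CommRing R] [CommRing T] (ρ : R →+* T) : Br R →* Br T :=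
  letI := ρ.toAlgebra
  baseChange R T

end Br

/-! ### Galois extensions -/

section Galois

/-- For a group `G` acting `R`-linearly by ring automorphisms on an `R`-algebra `S`, the map
`Γ : S ⊗[R] S → S(G)`, `Γ (s ⊗ t) = ∑ g, s g(t) δ_g`, where `S(G)` is the algebra of all maps from
`G` to `S`. -/
noncomputable def galoisMap (R S G : Type*) [CommRing R] [Ring S] [Algebra R S] [Group G]
    [MulSemiringAction G S] [SMulCommClass G R S] : S ⊗[R] S →ₗ[R] (G → S) :=
  LinearMap.pi fun g => LinearMap.mul' R S ∘ₗ
    (DistribSMul.toLinearMap R S g).lTensor S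

@[simp]
theorem galoisMap_tmul (R S G : Type*) [CommRing R] [Ring S] [Algebra R S] [Group G]
    [MulSemiringAction G S] [SMulCommClass G R S] (s t : S) (g : G) :
    galoisMap R S G (s ⊗ₜ t) g = s * g • t := by
  simp [galoisMap]

/-- `R → S` is a `G`-Galois extension (`R` commutative, `S` an `R`-algebra, `G` a group
acting on `S` by ring automorphisms and trivially on the image of `R`, which is the same as acting
by `R`-linear ring automorphisms): `S` is faithfully flat over `R` and `Γ` is bijective. -/
structure IsGaloisExtension (R S G : Type*) [CommRing R] [Ring S] [Algebra R S] [Group G]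
    [MulSemiringAction G S] [SMulCommClass G R S] : Prop where
  faithfullyFlat : Module.FaithfullyFlat R S
  bijective : Function.Bijective (galoisMap R S G)

/-- `S` is an Azumaya `R`-algebra which is `G`-Galois over `R` for some finite group `G`
and some action of `G` on `S`. -/
def IsGaloisAzumaya (R S : Type*) [CommRing R] [Ring S] [Algebra R S] : Prop :=
  IsAzumaya R S ∧ ∃ (G : Type) (_ : Group G) (_ : Finite G) (_ : MulSemiringAction G S)
    (_ : SMulCommClass G R S), IsGaloisExtension R S G

theorem IsGaloisAzumaya.self (R : Type*) [CommRing R] : IsGaloisAzumaya R R := by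
  let act : MulSemiringAction Unit R :=
    { smul := fun _ r => r, one_smul := fun _ => rfl, mul_smul := fun _ _ _ => rfl,
      smul_zero := fun _ => rfl, smul_add := fun _ _ _ => rfl, smul_one := fun _ => rfl,
      smul_mul := fun _ _ _ => rfl }
  have comm : SMulCommClass Unit R R := ⟨fun _ _ _ => rfl⟩
  refine ⟨IsAzumaya.id R, Unit, inferInstance, inferInstance, act, comm, inferInstance, ?_⟩
  have h : (galoisMap R R Unit : R ⊗[R] R →ₗ[R] (Unit → R)) =
      ((TensorProduct.lid R R) ≪≫ₗ (LinearEquiv.funUnique Unit R R).symm).toLinearMap := by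
    refine TensorProduct.ext' fun s t => funext fun g => ?_
    rw [galoisMap_tmul]
    rfl
  rw [h]
  exact LinearEquiv.bijective _

open MulOpposite in
theorem IsGaloisAzumaya.opposite {R S : Type*} [CommRing R] [Ring S] [Algebra R S]
    (h : IsGaloisAzumaya R S) : IsGaloisAzumaya R Sᵐᵒᵖ := by
  obtain ⟨hA, G, _, _, act, comm, hG⟩ := h
  let act' : MulSemiringAction G Sᵐᵒᵖ :=
    { smul := fun g s => op (g • s.unop)
      one_smul := fun s => unop_injective (one_smul G s.unop)
      mul_smul := fun g h s => unop_injective (mul_smul g h s.unop)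
      smul_zero := fun g => unop_injective (smul_zero g)
      smul_add := fun g s t => unop_injective (smul_add g s.unop t.unop)
      smul_one := fun g => unop_injective (smul_one g)
      smul_mul := fun g s t => unop_injective (smul_mul' g t.unop s.unop) }
  have comm' : SMulCommClass G R Sᵐᵒᵖ :=
    ⟨fun g r s => unop_injective (smul_comm g r s.unop)⟩
  refine ⟨inferInstance, G, inferInstance, inferInstance, act', comm', ?_, ?_⟩
  · have := hG.faithfullyFlat
    exact Module.FaithfullyFlat.of_linearEquiv R S (opLinearEquiv R).symm
  · let e1 : Sᵐᵒᵖ ⊗[R] Sᵐᵒᵖ ≃ₗ[R] S ⊗[R] S :=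
      TensorProduct.comm R _ _ ≪≫ₗ
        TensorProduct.congr (opLinearEquiv R).symm (opLinearEquiv R).symm
    let e2 : S ⊗[R] S ≃ₗ[R] (G → S) := LinearEquiv.ofBijective _ hG.bijective
    let c : (G → S) → (G → Sᵐᵒᵖ) := fun F g => op (g • F g⁻¹)
    have hc : Function.Bijective c := by
      refine Function.bijective_iff_has_inverse.2 ⟨fun F g => g • (F g⁻¹).unop, ?_, ?_⟩
      · intro F
        funext g
        simp [c]
      · intro F
        funext g
        simp [c]
    have key : (galoisMap R Sᵐᵒᵖ G : Sᵐᵒᵖ ⊗[R] Sᵐᵒᵖ → (G → Sᵐᵒᵖ)) = c ∘ e2 ∘ e1 := by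
      funext z
      induction z using TensorProduct.induction_on with
      | zero => funext g; simp [c]
      | add x y hx hy =>
        rw [map_add, hx, hy]
        funext g
        simp [c]
      | tmul s t =>
        funext g
        have h1 : (c ∘ e2 ∘ e1) (s ⊗ₜ t) g =
          op (g • galoisMap R S G (t.unop ⊗ₜ s.unop) g⁻¹) := rfl
        rw [h1, galoisMap_tmul, galoisMap_tmul]
        apply unop_injective
        rw [unop_op, smul_mul', smul_inv_smul]
        rfl
    rw [key]
    exact hc.comp (e2.bijective.comp e1.bijective)

theorem IsGaloisAzumaya.tensor {R S S' : Type*} [CommRing R] [Ring S] [Algebra R S]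
    [Ring S'] [Algebra R S'] (h : IsGaloisAzumaya R S) (h' : IsGaloisAzumaya R S') :
    IsGaloisAzumaya R (S ⊗[R] S') := by
  obtain ⟨hA, G, _, _, act, comm, hG⟩ := h
  obtain ⟨hA', G', _, _, act', comm', hG'⟩ := h'
  let f (g : G) : S →ₐ[R] S := MulSemiringAction.toAlgHom R S g
  let f' (g : G') : S' →ₐ[R] S' := MulSemiringAction.toAlgHom R S' g
  let m (g : G × G') : S ⊗[R] S' →ₐ[R] S ⊗[R] S' := Algebra.TensorProduct.map (f g.1) (f' g.2)
  have m_one : m 1 = AlgHom.id R _ := by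
    ext <;> simp [m, f, f']
  have m_mul (g h) : m (g * h) = (m g).comp (m h) := by
    ext <;> simp [m, f, f', mul_smul]
  let a : MulSemiringAction (G × G') (S ⊗[R] S') :=
    { smul := fun g x => m g x
      one_smul := fun x => DFunLike.congr_fun m_one x
      mul_smul := fun g h x => DFunLike.congr_fun (m_mul g h) x
      smul_zero := fun g => map_zero (m g)
      smul_add := fun g => map_add (m g)
      smul_one := fun g => map_one (m g)
      smul_mul := fun g => map_mul (m g) }
  have comm'' : SMulCommClass (G × G') R (S ⊗[R] S') := ⟨fun g r x => map_smul (m g) r x⟩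
  refine ⟨inferInstance, G × G', inferInstance, inferInstance, a, comm'', ?_, ?_⟩
  · have := hG.faithfullyFlat
    have := hG'.faithfullyFlat
    have h1 : Module.FaithfullyFlat R (S' ⊗[R] S) := by
      rw [Module.FaithfullyFlat.iff_flat_and_lTensor_reflects_triviality]
      refine ⟨inferInstance, fun N _ _ hN => ?_⟩
      have e := TensorProduct.assoc R S' S N
      have := e.symm.subsingleton
      have := Module.FaithfullyFlat.lTensor_reflects_triviality R S' (S ⊗[R] N)
      exact Module.FaithfullyFlat.lTensor_reflects_triviality R S N
    exact Module.FaithfullyFlat.of_linearEquiv R _ (TensorProduct.comm R S S')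
  · classical
    have : Fintype G := Fintype.ofFinite G
    have : Fintype G' := Fintype.ofFinite G'
    let e1 : (S ⊗[R] S') ⊗[R] (S ⊗[R] S') ≃ₗ[R] (S ⊗[R] S) ⊗[R] (S' ⊗[R] S') :=
      TensorProduct.tensorTensorTensorComm R S S' S S'
    let e2 : (S ⊗[R] S) ⊗[R] (S' ⊗[R] S') ≃ₗ[R] (G → S) ⊗[R] (G' → S') :=
      TensorProduct.congr (LinearEquiv.ofBijective _ hG.bijective)
        (LinearEquiv.ofBijective _ hG'.bijective)
    let e3 : (G → S) ⊗[R] (G' → S') ≃ₗ[R] (G' → S' ⊗[R] (G → S)) :=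
      TensorProduct.piRight R R (G → S) (fun _ : G' => S') ≪≫ₗ
        LinearEquiv.piCongrRight fun _ => TensorProduct.comm R _ _
    let e4 : (G' → S' ⊗[R] (G → S)) ≃ₗ[R] (G' → G → S ⊗[R] S') :=
      LinearEquiv.piCongrRight fun _ => TensorProduct.piRight R R S' (fun _ : G => S) ≪≫ₗ
        LinearEquiv.piCongrRight fun _ => TensorProduct.comm R _ _
    let c : (G' → G → S ⊗[R] S') → (G × G' → S ⊗[R] S') := fun F g => F g.2 g.1
    have hc : Function.Bijective c :=
      Function.bijective_iff_has_inverse.2 ⟨fun F g' g => F (g, g'), fun _ => rfl, fun _ => rfl⟩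
    let e := e1 ≪≫ₗ e2 ≪≫ₗ e3 ≪≫ₗ e4
    have key : (galoisMap R (S ⊗[R] S') (G × G') : _ → (G × G' → S ⊗[R] S')) = c ∘ e := by
      have hadd : ∀ x y, c (e (x + y)) = c (e x) + c (e y) := fun x y => by
        rw [map_add]; rfl
      have hzero : c (e 0) = 0 := by rw [map_zero]; rfl
      funext z
      induction z using TensorProduct.induction_on with
      | zero => rw [map_zero, Function.comp_apply, hzero]
      | add x y hx hy => rw [map_add, hx, hy]; simp only [Function.comp_apply, hadd]
      | tmul x y =>
        induction x using TensorProduct.induction_on with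
        | zero => rw [TensorProduct.zero_tmul, map_zero, Function.comp_apply, hzero]
        | add x x' hx hx' =>
          rw [TensorProduct.add_tmul, map_add, hx, hx']; simp only [Function.comp_apply, hadd]
        | tmul s s' =>
          induction y using TensorProduct.induction_on with
          | zero => rw [TensorProduct.tmul_zero, map_zero, Function.comp_apply, hzero]
          | add y y' hy hy' =>
            rw [TensorProduct.tmul_add, map_add, hy, hy']; simp only [Function.comp_apply, hadd]
          | tmul t t' =>
            funext g
            have h1 : (c ∘ e) ((s ⊗ₜ s') ⊗ₜ (t ⊗ₜ t')) g =
              galoisMap R S G (s ⊗ₜ t) g.1 ⊗ₜ galoisMap R S' G' (s' ⊗ₜ t') g.2 := by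
              simp [e, e1, e2, e3, e4, c]
            rw [h1, galoisMap_tmul, galoisMap_tmul, galoisMap_tmul]
            exact Algebra.TensorProduct.tmul_mul_tmul _ _ _ _
    rw [key]
    exact hc.comp e.bijective

end Galois

/-! ### The Brauer-Galois group -/

/-- The Brauer-Galois group of `R`: the subgroup of `Br R` of those classes that contain a
Galois-Azumaya extension of `R`. -/
def BrGal (R : Type u) [CommRing R] : Subgroup (Br R) where
  carrier := {ξ | ∃ (S : Type u) (_ : Ring S) (_ : Algebra R S) (_ : IsAzumaya R S),
    IsGaloisAzumaya R S ∧ ξ = Br.mk R S}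
  one_mem' := ⟨R, inferInstance, inferInstance, IsAzumaya.id R, IsGaloisAzumaya.self R, rfl⟩
  mul_mem' := by
    rintro _ _ ⟨S, _, _, _, h, rfl⟩ ⟨S', _, _, _, h', rfl⟩
    exact ⟨S ⊗[R] S', inferInstance, inferInstance, inferInstance, h.tensor h', rfl⟩
  inv_mem' := by
    rintro _ ⟨S, _, _, _, h, rfl⟩
    exact ⟨Sᵐᵒᵖ, inferInstance, inferInstance, inferInstance, h.opposite, rfl⟩

end BrauerGalois

open CategoryTheory

/-! Being Galois-Azumaya survives an arbitrary change of base, with no flatness needed along R → T.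
Let G act on T ⊗ S through the second factor. Azumaya algebras and faithfully flat modules are
stable under base change. The Galois map of T ⊗ S over T is id ⊗ Γ, once (T ⊗ S) ⊗_T (T ⊗ S) is
identified with T ⊗ (S ⊗ S) and T ⊗ ∏ S with ∏ (T ⊗ S). The second identification needs G finite.
Any tensor functor preserves isomorphisms, so bijectivity of Γ is inherited. This is
`IsGaloisAzumaya.baseChange`.

Hence extension of scalars carries Brauer-Galois classes to Brauer-Galois classes
(`Br.map_mem_brGal`) and restricts to the subgroups. Functoriality is inherited from the ambient
Brauer groups: `Br.map_id` comes from R ⊗ A ≅ A, and `Br.map_comp` from transitivity of extension of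
scalars. -/

namespace BrauerGalois

/-! ### Base change of Galois-Azumaya extensions -/

/-- Galois-Azumaya extensions are stable under extension of scalars. -/
theorem IsGaloisAzumaya.baseChange {R S : Type*} [CommRing R] [Ring S] [Algebra R S]
    (T : Type*) [CommRing T] [Algebra R T] (h : IsGaloisAzumaya R S) :
    IsGaloisAzumaya T (T ⊗[R] S) := by
  obtain ⟨_, G, _, _, _, _, hG⟩ := h
  -- The operator id ⊗ g is built as a T-algebra map. The action axioms then become equalities of
  -- algebra maps, which need checking only on elements 1 ⊗ s, and T-linearity of the action comes
  -- for free.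
  let m (g : G) : T ⊗[R] S →ₐ[T] T ⊗[R] S :=
    Algebra.TensorProduct.map (AlgHom.id T T) (MulSemiringAction.toAlgHom R S g)
  have m_one : m 1 = AlgHom.id T _ := by
    ext; simp [m]
  have m_mul (g h) : m (g * h) = (m g).comp (m h) := by
    ext; simp [m, mul_smul]
  let act : MulSemiringAction G (T ⊗[R] S) :=
    { smul := fun g x => m g x
      one_smul := fun x => DFunLike.congr_fun m_one x
      mul_smul := fun g h x => DFunLike.congr_fun (m_mul g h) x
      smul_zero := fun g => map_zero (m g)
      smul_add := fun g => map_add (m g)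
      smul_one := fun g => map_one (m g)
      smul_mul := fun g => map_mul (m g) }
  have comm : SMulCommClass G T (T ⊗[R] S) := ⟨fun g t x => map_smul (m g) t x⟩
  refine ⟨inferInstance, G, inferInstance, inferInstance, act, comm, ?_, ?_⟩
  · have := hG.faithfullyFlat
    infer_instance
  · classical
    -- Finiteness of G enters here: it lets T ⊗ - commute with the product over G in `piRight`.
    have : Fintype G := Fintype.ofFinite G
    -- The candidate for the new Galois map: regroup to T ⊗ (S ⊗ S), apply id ⊗ Γ, then distribute T
    -- over the product. Each factor is an isomorphism, so only the equality with `galoisMap`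
    -- remains.
    let e : (T ⊗[R] S) ⊗[T] (T ⊗[R] S) ≃ₗ[T] (G → T ⊗[R] S) :=
      (TensorProduct.AlgebraTensorModule.distribBaseChange R T S S).symm ≪≫ₗ
        TensorProduct.AlgebraTensorModule.congr (LinearEquiv.refl T T)
          (LinearEquiv.ofBijective _ hG.bijective) ≪≫ₗ
        TensorProduct.piRight R T T (fun _ : G => S)
    have key : galoisMap T (T ⊗[R] S) G = e.toLinearMap := by
      -- Both sides are T-linear, so it suffices to compare them on (1 ⊗ s) ⊗ (1 ⊗ s'), where each
      -- has g-component 1 ⊗ s g(s').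
      ext s s' g
      have h1 : e ((1 ⊗ₜ s) ⊗ₜ (1 ⊗ₜ s')) g = 1 ⊗ₜ[R] galoisMap R S G (s ⊗ₜ s') g := by
        simp [e]
      have h2 : galoisMap T (T ⊗[R] S) G ((1 ⊗ₜ s) ⊗ₜ (1 ⊗ₜ s')) g =
          (1 * 1) ⊗ₜ[R] (s * g • s') := by
        rw [galoisMap_tmul]
        -- The action was defined through `m`, so g • (1 ⊗ s') unfolds to 1 ⊗ g • s' and the product
        -- rule applies up to definitional equality.
        exact Algebra.TensorProduct.tmul_mul_tmul _ _ _ _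
      simpa using h2.trans (by rw [h1, galoisMap_tmul, mul_one])
    rw [key]
    exact e.bijective

/-! ### Functoriality of the Brauer group -/

namespace Br

theorem map_id (R : Type u) [CommRing R] : map (RingHom.id R) = MonoidHom.id (Br R) := by
  -- The tensor product in `map` uses the algebra structure coming from the ring homomorphism.
  -- Replacing it by the standard one makes R ⊗ A ≅ A applicable.
  have h : (RingHom.id R).toAlgebra = Algebra.id R := rfl
  ext x
  induction x using ind with | h A
  rw [map, h]
  exact mk_eq_of_algEquiv (Algebra.TensorProduct.lid R A)

/-- The isomorphisms U ⊗_R A ≅ (U ⊗_T T) ⊗_R A ≅ U ⊗_T (T ⊗_R A) identify the two representatives.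
-/
theorem map_comp {R T U : Type u} [CommRing R] [CommRing T] [CommRing U] (σ : T →+* U)
    (ρ : R →+* T) : map (σ.comp ρ) = (map σ).comp (map ρ) := by
  let _ := ρ.toAlgebra
  let _ := σ.toAlgebra
  let _ := (σ.comp ρ).toAlgebra
  have : IsScalarTower R T U := .of_algebraMap_eq fun _ => rfl
  ext x
  induction x using ind with | h A
  exact mk_eq_of_algEquiv <|
    (Algebra.TensorProduct.congr (Algebra.TensorProduct.rid T U U).symm AlgEquiv.refl).trans
      (Algebra.TensorProduct.assoc R T U U T A)

/-- Membership asks for a single Galois representative, and the base change of one such S represents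
the image class. -/
theorem map_mem_brGal {R T : Type u} [CommRing R] [CommRing T] (ρ : R →+* T) {ξ : Br R}
    (hξ : ξ ∈ BrGal R) : map ρ ξ ∈ BrGal T := by
  let _ := ρ.toAlgebra
  obtain ⟨S, _, _, _, h, rfl⟩ := hξ
  exact ⟨T ⊗[R] S, inferInstance, inferInstance, inferInstance, h.baseChange T, rfl⟩

end Br

/-! ### The functor of Brauer-Galois groups -/

/-- The restriction of `Br(ρ)` to the Brauer-Galois groups. -/
noncomputable def BrGal.map {R T : Type u} [CommRing R] [CommRing T] (ρ : R →+* T) :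
    BrGal R →* BrGal T :=
  ((Br.map ρ).comp (BrGal R).subtype).codRestrict _ fun ξ => Br.map_mem_brGal ρ ξ.2

open CategoryTheory in
/-- The Brauer-Galois group as a functor on commutative `k`-algebras. -/
noncomputable def brGalFunctor (k : Type u) [CommRing k] :
    CommAlgCat.{v} k ⥤ GrpCat.{v + 1} where
  obj R := GrpCat.of (BrGal R)
  map ρ := GrpCat.ofHom (BrGal.map (ρ.hom : _ →+* _))
  map_id R := by
    refine GrpCat.hom_ext (MonoidHom.ext fun ξ => ?_)
    -- Equality in the subgroup is tested in the full Brauer group, so the functor laws reduce to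
    -- those of `Br.map`.
    exact Subtype.ext (DFunLike.congr_fun (Br.map_id R) ξ.1)
  map_comp ρ σ := by
    refine GrpCat.hom_ext (MonoidHom.ext fun ξ => ?_)
    exact Subtype.ext (DFunLike.congr_fun (Br.map_comp σ.hom.toRingHom ρ.hom.toRingHom) ξ.1)

end BrauerGalois

/-- `R ↦ BrGal R` is a functor from commutative `k`-algebras to groups, and its value at a
morphism `ρ : R ⟶ T` is the restriction of the extension of scalars `Br R → Br T` along `ρ`. -/
theorem corollary3p8 (k : Type u) [CommRing k] :
    ∃ (F : CommAlgCat.{v} k ⥤ GrpCat.{v + 1})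
      (hF : ∀ R : CommAlgCat.{v} k, F.obj R = GrpCat.of (BrauerGalois.BrGal R)),
      ∀ (R T : CommAlgCat.{v} k) (ρ : R ⟶ T) (ξ : BrauerGalois.BrGal R),
        ((eqToHom (hF R).symm ≫ F.map ρ ≫ eqToHom (hF T) :
            GrpCat.of (BrauerGalois.BrGal R) ⟶ GrpCat.of (BrauerGalois.BrGal T)).hom ξ :
          BrauerGalois.BrGal T) = BrauerGalois.Br.map (ρ.hom : R →+* T) (ξ : BrauerGalois.Br R) := by
  -- The object equalities hold definitionally, so the `eqToHom` transports reduce to identities.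
  -- What is left is the underlying value of the codomain-restricted map, which is `Br.map` by
  -- construction.
  exact ⟨BrauerGalois.brGalFunctor k, fun _ => rfl, fun _ _ _ _ => rfl⟩
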